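/- **Setting.** Datasets are finite sets. A randomized learning algorithm $\mathcal A$ maps a dataset $\mathcal D$ to random parameters $\hat{\mathbf x}=\mathcal A(\mathcal D)\in\mathbb R^d$; for $\mathcal D_f\subseteq\mathcal D$ put $\mathcal D_r=\mathcal D\setminus\mathcal D_f$ and $\hat{\mathbf x}'=\mathcal A(\mathcal D_r)$. Two laws $\mu,\nu$ are $(\varepsilon,\delta)$-indistinguishable if $\mu(O)\le e^{\varepsilon}\nu(O)+\delta$ and $\nu(O)\le e^{\varepsilon}\mu(O)+\delta$ for all measurable $O$. A mechanism $\mathcal U(\hat{\mathbf x},\mathcal D,\mathcal D_f)$ is an $(\varepsilon,\delta)$-unlearning algorithm for $\mathcal A$ if there is a randomized algorithm $\bar{\mathcal A}$ such that, for all $\mathcal D_f\subseteq\mathcal D$, the laws of $\mathcal U(\mathcal A(\mathcal D),\mathcal D,\mathcal D_f)$ and $\bar{\mathcal A}(\mathcal D\setminus\mathcal D_f)$ are $(\varepsilon,\delta)$-indistinguishable. **Blocks.** Let $A_i\in\mathbb R^{d\times r_i}$ ($1\le i\le k$, $\sum_i r_i=d$) be such that $A=[A_1\cdots A_k]$ satisfies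 $A^\top A=I_d$; so every $W\in\mathbb R^d$ is uniquely $W=\sum_i A_iB_i$, with $B_i=A_i^\top W$. **Block-wise noisy fine-tuning.** Starting from $\hat{\mathbf x}$, the blocks $i=1,\dots,k$ are processed one after the other. During stage $i$, for $T_i$ steps, all other blocks are frozen and $$B_i\leftarrow B_i-\gamma_i\bigl(\Pi_{C_{1,i}}(A_i^\top g)+\lambda_iB_i\bigr)+\xi,\qquad \xi\sim\mathcal N(0,\sigma_i^2I_{r_i})\ \text{fresh and independent},$$ where $\Pi_C(v)=v\min\{C/\|v\|,1\}$, $\gamma_i>0$, $\lambda_i\ge0$, $\gamma_i\lambda_i<1$, $C_{1,i},\sigma_i>0$, and $g$ is the (possibly stochastic) gradient at the current model, computed on $\mathcal D_r$: a measurable function, depending on $\mathcal D_r$ and the step, of the current model and an independent random seed. Finally standard fine-tuning on $\mathcal D_r$ is run, which may be any randomized map depending only on $\mathcal D_r$. **Calibration.** Let $q>1$ and $\varepsilon_i^{\text{rényi}}\ge0$. Block $i$ is calibrated to the Rényi budget $\varepsilon_i^{\text{rényi}}$ of order $q$ with radius $C_0$ if, with $\rho_i=1-\gamma_i\lambda_i$,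 $$2C_0\rho_i^{T_i}+\sum_{t=0}^{T_i-1}\rho_i^{T_i-1-t}\,2\gamma_iC_{1,i}\ \le\ \sqrt{\frac{2\varepsilon_i^{\text{rényi}}\sigma_i^2}{q}}\ \sqrt{\sum_{t=0}^{T_i-1}\rho_i^{2(T_i-1-t)}} .$$ **Theorem.** Let $0<\delta\le1$, $\varepsilon_i=\varepsilon_i^{\text{rényi}}+\frac{\log(1/\delta)}{q-1}$ and $$\varepsilon=\sum_{i=1}^k\varepsilon_i^{\text{rényi}}+\frac{\log(1/\delta)}{q-1}.$$ Then $\varepsilon=\sum_{i=1}^k\varepsilon_i-(k-1)\frac{\log(1/\delta)}{q-1}$, and: 1. (Without model clipping, conditionally on proximity.) Fix couplings of $\hat{\mathbf x}$ and $\hat{\mathbf x}'$ and $\rho\in(0,1)$, and let the initial discrepancy $\Delta(\rho)$ be the smallest number with $\Pr[\|\hat{\mathbf x}-\hat{\mathbf x}'\|\le\Delta(\rho)]\ge1-\rho$. If every block is calibrated with radius $C_0=\Delta/2$, then for all $\mathcal D_f\subseteq\mathcal D$ for which $\Delta(\rho)\le\Delta$, conditionally on $\|\hat{\mathbf x}-\hat{\mathbf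 x}'\|\le\Delta$, the output of block-wise noisy fine-tuning run from $\hat{\mathbf x}$ for $(\mathcal D,\mathcal D_f)$ and its output run from $\hat{\mathbf x}'$ for $(\mathcal D_r,\varnothing)$ are $(\varepsilon,\delta)$-indistinguishable. 2. (With model clipping, unconditionally.) If $C_0>0$ and every block is calibrated with radius $C_0$, then the mechanism $\mathcal U$ that first replaces $\hat{\mathbf x}$ by $\Pi_{C_0}(\hat{\mathbf x})$ and then runs block-wise noisy fine-tuning is an $(\varepsilon,\delta)$-unlearning algorithm for $\mathcal A$, with certifying algorithm $\bar{\mathcal A}(\mathcal D_r)=\mathcal U(\mathcal A(\mathcal D_r),\mathcal D_r,\varnothing)$. -/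

import Mathlib

open MeasureTheory ProbabilityTheory
open scoped BigOperators ENNReal

noncomputable section

/-- The parameter space `ℝ^n` with its Euclidean norm. -/
abbrev Vec (n : ℕ) : Type := EuclideanSpace ℝ (Fin n)

/-! ### Indistinguishability and unlearning -/

/-- `(ε, δ)`-indistinguishability of two laws, in both directions, for all measurable events. -/
def Indistinguishable {X : Type*} [MeasurableSpace X] (ε δ : ℝ) (μ ν : Measure X) : Prop :=
  ∀ O : Set X, MeasurableSet O →
    μ O ≤ ENNReal.ofReal (Real.exp ε) * ν O + ENNReal.ofReal δ ∧
    ν O ≤ ENNReal.ofReal (Real.exp ε) * μ O + ENNReal.ofReal δ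

/-- The certifying algorithm `Abar` witnesses that `U` is `(ε, δ)`-unlearning for `𝒜`.
`𝒜 D` is the law of the trained model; `U D Df` is the (randomized) unlearning mechanism, so
`U D Df ∘ₘ 𝒜 D` is the law of `U(𝒜(D), D, Df)`. -/
def CertifiesUnlearning {Z X : Type*} [DecidableEq Z] [MeasurableSpace X] (ε δ : ℝ)
    (𝒜 : Finset Z → Measure X) (U : Finset Z → Finset Z → Kernel X X)
    (Abar : Finset Z → Measure X) : Prop :=
  ∀ D Df : Finset Z, Df ⊆ D → Indistinguishable ε δ (U D Df ∘ₘ 𝒜 D) (Abar (D \ Df))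

/-- `U` is an `(ε, δ)`-unlearning algorithm for `𝒜`. -/
def IsUnlearning {Z X : Type*} [DecidableEq Z] [MeasurableSpace X] (ε δ : ℝ)
    (𝒜 : Finset Z → Measure X) (U : Finset Z → Finset Z → Kernel X X) : Prop :=
  ∃ Abar : Finset Z → Measure X,
    (∀ D, IsProbabilityMeasure (Abar D)) ∧ CertifiesUnlearning ε δ 𝒜 U Abar

/-- The conversion `ε^rényi ↦ ε^rényi + log (1/δ) / (q - 1)`. -/
def rdpToDP (q δ e : ℝ) : ℝ := e + Real.log (1 / δ) / (q - 1)

/-! ### Initial discrepancy -/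

/-- `π` is a coupling of `μ` and `ν`. -/
def IsCoupling {X : Type*} [MeasurableSpace X] (π : Measure (X × X)) (μ ν : Measure X) : Prop :=
  π.map Prod.fst = μ ∧ π.map Prod.snd = ν

/-- The proximity event `‖x̂ - x̂'‖ ≤ r` for a pair of models. -/
def proximityEvent (d : ℕ) (r : ℝ) : Set (Vec d × Vec d) := {p | ‖p.1 - p.2‖ ≤ r}

/-- The smallest `Δ` such that `‖x̂ - x̂'‖ ≤ Δ` with probability at least `1 - ρ` under the
coupling `π`. -/
def initialDiscrepancy {d : ℕ} (π : Measure (Vec d × Vec d)) (ρ : ℝ) : ℝ :=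
  sInf {r : ℝ | ENNReal.ofReal (1 - ρ) ≤ π (proximityEvent d r)}

/-! ### Orthogonal blocks -/

/-- The concatenation `[A_1 ⋯ A_k]`. -/
def blockConcat {d k : ℕ} {r : Fin k → ℕ} (A : ∀ i, Matrix (Fin d) (Fin (r i)) ℝ) :
    Matrix (Fin d) (Σ i, Fin (r i)) ℝ :=
  fun a p => A p.1 a p.2

/-- `r_1 + ⋯ + r_k = d` and `Aᵀ A = I`, where `A = [A_1 ⋯ A_k]`. -/
def IsBlockDecomposition {d k : ℕ} {r : Fin k → ℕ} (A : ∀ i, Matrix (Fin d) (Fin (r i)) ℝ) :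
    Prop :=
  ∑ i, r i = d ∧ (blockConcat A).transpose * blockConcat A = 1

/-! ### Noisy fine-tuning of one block -/

/-- The clipping operator `Π_C(v) = v · min (C / ‖v‖) 1`. -/
def clip {n : ℕ} (C : ℝ) (v : Vec n) : Vec n := min (C / ‖v‖) 1 • v

/-- The Gaussian law `N(0, σ² I_n)`. -/
def gaussianNoise (n : ℕ) (σ : ℝ) : Measure (Vec n) := (stdGaussian (Vec n)).map (fun v => σ • v)

/-- Hyperparameters of noisy fine-tuning: learning rate `γ`, weight decay `lam`, gradient clipping
radius `C₁`, noise level `σ`, number of steps `T`. -/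
structure NFTParams where
  γ : ℝ
  lam : ℝ
  C₁ : ℝ
  σ : ℝ
  T : ℕ

/-- Admissible hyperparameters. -/
def NFTParams.Admissible (p : NFTParams) : Prop :=
  0 < p.γ ∧ 0 ≤ p.lam ∧ p.γ * p.lam < 1 ∧ 0 < p.C₁ ∧ 0 < p.σ

/-- The calibration of the noise `σ` and the number of steps `T` to the Rényi budget `e` of order
`q`, for models initially clipped to radius `C₀` (initial distance at most `2 C₀`):
`(1 - γλ)^T 2C₀ + ∑_{t<T} (1 - γλ)^(T-1-t) 2γC₁ ≤ √(2eσ²/q) √(∑_{t<T} (1 - γλ)^(2(T-1-t)))`. -/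
def NFTParams.Calibrated (p : NFTParams) (q C₀ e : ℝ) : Prop :=
  (1 - p.γ * p.lam) ^ p.T * (2 * C₀)
      + ∑ t ∈ Finset.range p.T, (1 - p.γ * p.lam) ^ (p.T - 1 - t) * (2 * p.γ * p.C₁)
    ≤ Real.sqrt (2 * e * p.σ ^ 2 / q)
      * Real.sqrt (∑ t ∈ Finset.range p.T, ((1 - p.γ * p.lam) ^ (p.T - 1 - t)) ^ 2)

/-- The update of the block with matrix `A` (all other coordinates are frozen), for the current
full gradient `g` and the noise `ξ`: in terms of the block coordinates `B = Aᵀ x`,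
`B ↦ B - γ (Π_{C₁}(Aᵀ g) + λ B) + ξ`. -/
def blockUpdate {d n : ℕ} (A : Matrix (Fin d) (Fin n) ℝ) (p : NFTParams)
    (g x : Vec d) (ξ : Vec n) : Vec d :=
  x + A.toEuclideanLin
    (-(p.γ • (clip p.C₁ (A.transpose.toEuclideanLin g)
      + p.lam • A.transpose.toEuclideanLin x)) + ξ)

/-- One step on a block, with fresh noise. The state is `(ω, x)`: `ω` is the random seed of the
gradient oracle (e.g. the choice of all minibatches), which stays fixed, `x` the model. -/
def blockStep {S : Type*} [MeasurableSpace S] {d n : ℕ} (A : Matrix (Fin d) (Fin n) ℝ)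
    (p : NFTParams) (g : S → Vec d → Vec d) : Kernel (S × Vec d) (S × Vec d) :=
  (Kernel.id ×ₖ Kernel.const (S × Vec d) (gaussianNoise n p.σ)).map
    (fun s => (s.1.1, blockUpdate A p (g s.1.1 s.1.2) s.1.2 s.2))

/-- The first `T` steps on a block; `g t` is the gradient oracle at step `t`. -/
def blockSteps {S : Type*} [MeasurableSpace S] {d n : ℕ} (A : Matrix (Fin d) (Fin n) ℝ)
    (p : NFTParams) (g : ℕ → S → Vec d → Vec d) : ℕ → Kernel (S × Vec d) (S × Vec d)
  | 0 => Kernel.id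
  | T + 1 => blockStep A p (g T) ∘ₖ blockSteps A p g T

/-! ### Block-wise noisy fine-tuning -/

/-- The blocks `1, …, k` are processed one after the other, block `i` for `T_i` steps. -/
def allBlocks {S : Type*} [MeasurableSpace S] {d k : ℕ} {r : Fin k → ℕ}
    (A : ∀ i, Matrix (Fin d) (Fin (r i)) ℝ) (p : Fin k → NFTParams)
    (g : Fin k → ℕ → S → Vec d → Vec d) : Kernel (S × Vec d) (S × Vec d) :=
  Fin.foldl k (fun κ i => blockSteps (A i) (p i) (g i) (p i).T ∘ₖ κ) Kernel.id

/-- Block-wise noisy fine-tuning as an unlearning mechanism. The retained data `D \ Df` determine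
the gradient oracle `g (D \ Df)`, the law `ν (D \ Df)` of its seed, and the final standard
fine-tuning `F (D \ Df)` of all parameters, an arbitrary randomized map. -/
def blockwiseNFT {Z S : Type*} [DecidableEq Z] [MeasurableSpace S] {d k : ℕ} {r : Fin k → ℕ}
    (A : ∀ i, Matrix (Fin d) (Fin (r i)) ℝ) (p : Fin k → NFTParams)
    (g : Finset Z → Fin k → ℕ → S → Vec d → Vec d) (ν : Finset Z → Measure S)
    (F : Finset Z → Kernel (Vec d) (Vec d)) (D Df : Finset Z) : Kernel (Vec d) (Vec d) :=
  F (D \ Df) ∘ₖ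
    (allBlocks A p (g (D \ Df)) ∘ₖ (Kernel.const (Vec d) (ν (D \ Df)) ×ₖ Kernel.id)).map Prod.snd

/-- Block-wise noisy fine-tuning preceded by model clipping `x₀ = Π_{C₀}(x̂)`. -/
def clippedBlockwiseNFT {Z S : Type*} [DecidableEq Z] [MeasurableSpace S] {d k : ℕ}
    {r : Fin k → ℕ} (C₀ : ℝ)
    (A : ∀ i, Matrix (Fin d) (Fin (r i)) ℝ) (p : Fin k → NFTParams)
    (g : Finset Z → Fin k → ℕ → S → Vec d → Vec d) (ν : Finset Z → Measure S)
    (F : Finset Z → Kernel (Vec d) (Vec d)) (D Df : Finset Z) : Kernel (Vec d) (Vec d) :=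
  blockwiseNFT A p g ν F D Df ∘ₖ Kernel.id.map (clip C₀)

end

/-! Two runs of the algorithm on the same retained data are compared from starting points at
distance at most `2 * C₀`. In each noisy step on a block, part of the gap between the two
deterministic updates is absorbed by shifting the Gaussian noise of one run. A shift of norm `a`
costs `q * a ^ 2 / (2 * σ ^ 2)` in Rényi divergence of order `q`. Weight decay contracts the gap,
and each step adds at most `2 * γ * C₁` because both gradients are clipped. Calibration says exactly
that shifts of total cost at most the block's budget bring the gap in that block to `0`
(`NFTParams.Calibrated.exists_shifts`). The frozen blocks keep their gaps, so after the last block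
the two models coincide.

Coupling and divergence are tracked together by `RenyiDominated`, a Hölder-type inequality for test
functions compared along a relation of states. It composes with additive costs
(`RenyiDominated.comp`), the one-step case being `renyiDominated_blockStep`. Hence the Rényi budgets
add up over the blocks, and the conversion to `(ε, δ)` in `rpow_le_exp_mul_add` is paid only once.
The result for fixed starting points is then averaged over a coupling of the trained models: the
given one conditioned on proximity, or the independent one when clipping ensures proximity. -/

/-! ### Shifts of the Gaussian law -/

lemma gaussianReal_eq_withDensity_standard (s : ℝ) :
    gaussianReal s 1 = (gaussianReal 0 1).withDensity
      (fun x => ENNReal.ofReal (Real.exp (s * x - s ^ 2 / 2))) := by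
  rw [gaussianReal_of_var_ne_zero _ one_ne_zero, gaussianReal_of_var_ne_zero _ one_ne_zero,
    ← withDensity_mul _ (measurable_gaussianPDF _ _) (by fun_prop)]
  congr 1
  ext x
  simp only [Pi.mul_apply, gaussianPDF, gaussianPDFReal]
  rw [← ENNReal.ofReal_mul (by positivity), mul_assoc _ (Real.exp _) (Real.exp _), ← Real.exp_add]
  congr 3
  simp only [NNReal.coe_one]
  ring

lemma pi_gaussianReal_eq_withDensity {ι : Type*} [Fintype ι] (s : ι → ℝ) :
    Measure.pi (fun i => gaussianReal (s i) 1) =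
      (Measure.pi (fun _ : ι => gaussianReal 0 1)).withDensity
        (fun x => ∏ i, ENNReal.ofReal (Real.exp (s i * x i - s i ^ 2 / 2))) := by
  refine (Measure.pi_eq fun B hB => ?_)
  rw [withDensity_apply _ (MeasurableSet.univ_pi hB),
    ← lintegral_indicator (MeasurableSet.univ_pi hB)]
  have hind : ∀ x : ι → ℝ, (Set.univ.pi B).indicator
      (fun x => ∏ i, ENNReal.ofReal (Real.exp (s i * x i - s i ^ 2 / 2))) x =
      ∏ i, (B i).indicator
        (fun t => ENNReal.ofReal (Real.exp (s i * t - s i ^ 2 / 2))) (x i) := by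
    intro x
    by_cases hx : x ∈ Set.univ.pi B
    · rw [Set.indicator_of_mem hx]
      exact Finset.prod_congr rfl fun i _ => by rw [Set.indicator_of_mem (hx i trivial)]
    · rw [Set.indicator_of_notMem hx]
      simp only [Set.mem_univ_pi, not_forall] at hx
      obtain ⟨i, hi⟩ := hx
      exact (Finset.prod_eq_zero (Finset.mem_univ i) (Set.indicator_of_notMem hi _)).symm
  have hm : ∀ i, Measurable ((B i).indicator
      (fun t => ENNReal.ofReal (Real.exp (s i * t - s i ^ 2 / 2)))) := fun i =>
    Measurable.indicator (by fun_prop) (hB i)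
  simp_rw [hind]
  have hI := iIndepFun_pi (μ := fun _ : ι => gaussianReal 0 1)
    (X := fun i => (B i).indicator
      (fun t => ENNReal.ofReal (Real.exp (s i * t - s i ^ 2 / 2))))
    (fun i => (hm i).aemeasurable)
  rw [lintegral_prod_eq_prod_lintegral_of_indepFun Finset.univ _ hI
    (fun i => (hm i).comp (measurable_pi_apply i))]
  refine Finset.prod_congr rfl fun i _ => ?_
  rw [(measurePreserving_eval (fun _ : ι => gaussianReal 0 1) i).lintegral_comp (hm i),
    lintegral_indicator (hB i), gaussianReal_eq_withDensity_standard (s i),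
    withDensity_apply _ (hB i)]

/-- The Cameron–Martin formula, obtained coordinatewise from the product form of the standard
Gaussian. -/
lemma lintegral_add_stdGaussian {n : ℕ} (s : Vec n) {f : Vec n → ℝ≥0∞} (hf : Measurable f) :
    ∫⁻ x, f (s + x) ∂(stdGaussian (Vec n)) =
      ∫⁻ x, f x * ENNReal.ofReal (Real.exp (inner ℝ s x - ‖s‖ ^ 2 / 2)) ∂(stdGaussian (Vec n)) := by
  rw [← map_pi_eq_stdGaussian, lintegral_map (by fun_prop) (by fun_prop),
    lintegral_map (by fun_prop) (by fun_prop)]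
  have hadd := Measure.pi_map_pi (μ := fun _ : Fin n => gaussianReal 0 1)
    (f := fun i x => s i + x) (fun i => by fun_prop)
  simp only [gaussianReal_map_const_add, zero_add] at hadd
  calc ∫⁻ a, f (s + WithLp.toLp 2 a) ∂(Measure.pi fun _ : Fin n => gaussianReal 0 1)
      = ∫⁻ a, f (WithLp.toLp 2 a) ∂((Measure.pi fun _ : Fin n => gaussianReal 0 1).map
          (fun x i => s i + x i)) := by
        rw [lintegral_map (by fun_prop) (by fun_prop)]
        rfl
    _ = _ := by
        rw [hadd, pi_gaussianReal_eq_withDensity,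
          lintegral_withDensity_eq_lintegral_mul _ (by fun_prop) (by fun_prop)]
        refine lintegral_congr fun x => ?_
        rw [Pi.mul_apply, mul_comm, ← ENNReal.ofReal_prod_of_nonneg (fun _ _ => by positivity),
          ← Real.exp_sum, Finset.sum_sub_distrib, ← Finset.sum_div,
          EuclideanSpace.real_norm_sq_eq]
        simp [PiLp.inner_apply, mul_comm]

/-- The `q`-th moment of the likelihood ratio of a shifted standard Gaussian. -/
lemma lintegral_rpow_shift_density {n : ℕ} (q : ℝ) (s : Vec n) :
    ∫⁻ x, ENNReal.ofReal (Real.exp (inner ℝ s x - ‖s‖ ^ 2 / 2)) ^ q ∂(stdGaussian (Vec n)) =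
      ENNReal.ofReal (Real.exp (q * (q - 1) * ‖s‖ ^ 2 / 2)) := by
  -- The density for the shift `q • s` has integral `1`; completing the square reduces the `q`-th
  -- power to it.
  have h := lintegral_add_stdGaussian (q • s) (f := fun _ => (1 : ℝ≥0∞)) measurable_const
  simp only [lintegral_const, measure_univ, one_mul] at h
  have hpt : ∀ x : Vec n, ENNReal.ofReal (Real.exp (inner ℝ s x - ‖s‖ ^ 2 / 2)) ^ q =
      ENNReal.ofReal (Real.exp (q * (q - 1) * ‖s‖ ^ 2 / 2)) *
        ENNReal.ofReal (Real.exp (inner ℝ (q • s) x - ‖q • s‖ ^ 2 / 2)) := by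
    intro x
    rw [ENNReal.ofReal_rpow_of_pos (Real.exp_pos _), ← ENNReal.ofReal_mul (by positivity),
      ← Real.exp_mul, ← Real.exp_add, real_inner_smul_left, norm_smul, mul_pow,
      Real.norm_eq_abs, sq_abs]
    congr 2
    ring
  simp_rw [hpt]
  rw [lintegral_const_mul _ (by fun_prop), ← h, mul_one]

/-- After the change of variables, Hölder with exponents `q / (q - 1)` and `q` separates `h` from
the density. The `L^q` norm of the density, `exp ((q - 1) * ‖s‖ ^ 2 / 2)`, then moves inside the
power `(q - 1) / q`. -/
lemma lintegral_rpow_add_stdGaussian_le {n : ℕ} {q : ℝ} (hq : 1 < q) (s : Vec n)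
    {h : Vec n → ℝ≥0∞} (hh : Measurable h) :
    ∫⁻ x, h (s + x) ^ ((q - 1) / q) ∂(stdGaussian (Vec n)) ≤
      (ENNReal.ofReal (Real.exp (q * ‖s‖ ^ 2 / 2)) * ∫⁻ x, h x ∂(stdGaussian (Vec n)))
        ^ ((q - 1) / q) := by
  have hq0 : 0 < q := by linarith
  have hq1 : 0 < q - 1 := by linarith
  have hconj : (q / (q - 1)).HolderConjugate q := by
    rw [Real.holderConjugate_iff]
    refine ⟨by rw [lt_div_iff₀ hq1]; linarith, by field_simp; ring⟩
  rw [lintegral_add_stdGaussian s (f := fun x => h x ^ ((q - 1) / q)) (by fun_prop)]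
  refine (ENNReal.lintegral_mul_le_Lp_mul_Lq _ hconj (by fun_prop) (by fun_prop)).trans ?_
  simp_rw [← ENNReal.rpow_mul]
  rw [lintegral_rpow_shift_density q, show (q - 1) / q * (q / (q - 1)) = 1 by field_simp,
    show 1 / (q / (q - 1)) = (q - 1) / q by field_simp,
    ENNReal.mul_rpow_of_nonneg _ _ (by positivity), mul_comm,
    ENNReal.ofReal_rpow_of_pos (Real.exp_pos _), ENNReal.ofReal_rpow_of_pos (Real.exp_pos _),
    ← Real.exp_mul, ← Real.exp_mul]
  simp only [ENNReal.rpow_one]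
  apply le_of_eq
  congr 3
  field_simp

/-- Hölder's inequality against the likelihood ratio of a shifted Gaussian: the functional form of
the Rényi divergence bound `q ‖s‖² / (2 σ²)`. -/
lemma lintegral_rpow_add_gaussianNoise_le {n : ℕ} {q σ : ℝ} (hq : 1 < q) (hσ : 0 < σ) (s : Vec n)
    {h : Vec n → ℝ≥0∞} (hh : Measurable h) :
    ∫⁻ x, h (s + x) ^ ((q - 1) / q) ∂(gaussianNoise n σ) ≤
      (ENNReal.ofReal (Real.exp (q * ‖s‖ ^ 2 / (2 * σ ^ 2))) * ∫⁻ x, h x ∂(gaussianNoise n σ))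
        ^ ((q - 1) / q) := by
  unfold gaussianNoise
  rw [lintegral_map (by fun_prop) (by fun_prop), lintegral_map (by fun_prop) (by fun_prop)]
  have hst := lintegral_rpow_add_stdGaussian_le hq (σ⁻¹ • s) (h := fun v => h (σ • v))
    (by fun_prop)
  have he : q * ‖σ⁻¹ • s‖ ^ 2 / 2 = q * ‖s‖ ^ 2 / (2 * σ ^ 2) := by
    rw [norm_smul, mul_pow, Real.norm_eq_abs, sq_abs]
    field_simp
  simpa only [he, smul_add, smul_inv_smul₀ hσ.ne'] using hst

instance (n : ℕ) (σ : ℝ) : IsProbabilityMeasure (gaussianNoise n σ) :=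
  Measure.isProbabilityMeasure_map (by fun_prop)

/-! ### Relational Rényi domination of Markov kernels -/

/-- Functional form of a Rényi divergence bound of order `q` and size `D` between `κ x` and `κ y`
for related `x, y`, which transports test functions along a relation of the outputs. With equality
as the output relation, it bounds `κ x O` by `(e ^ D * κ y O) ^ ((q - 1) / q)`. -/
def RenyiDominated {X Y : Type*} [MeasurableSpace X] [MeasurableSpace Y] (q D : ℝ)
    (R : X → X → Prop) (R' : Y → Y → Prop) (κ : Kernel X Y) : Prop :=
  ∀ f h : Y → ℝ≥0∞, Measurable f → Measurable h →
    (∀ x y, R' x y → f x ≤ h y ^ ((q - 1) / q)) →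
    ∀ x y, R x y →
      ∫⁻ a, f a ∂(κ x) ≤ (ENNReal.ofReal (Real.exp D) * ∫⁻ a, h a ∂(κ y)) ^ ((q - 1) / q)

namespace RenyiDominated

variable {X Y W : Type*} [MeasurableSpace X] [MeasurableSpace Y] [MeasurableSpace W] {q D E : ℝ}
  {R : X → X → Prop} {R' : Y → Y → Prop} {R'' : W → W → Prop}

lemma id : RenyiDominated q 0 R R Kernel.id := by
  intro f h hf hh hR x y hxy
  simpa [Kernel.id_apply, lintegral_dirac' _ hf, lintegral_dirac' _ hh] using hR x y hxy

/-- The conclusion for `η` has the shape of the hypothesis required by `κ`: the first domination is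
applied to the `η`-integrals of `f` and `h`, the latter multiplied by `exp E`. -/
lemma comp {κ : Kernel X Y} {η : Kernel Y W} (hκ : RenyiDominated q D R R' κ)
    (hη : RenyiDominated q E R' R'' η) : RenyiDominated q (D + E) R R'' (η ∘ₖ κ) := by
  intro f h hf hh hR x y hxy
  rw [Kernel.lintegral_comp _ _ _ hf, Kernel.lintegral_comp _ _ _ hh]
  have := hκ (fun b => ∫⁻ c, f c ∂(η b))
    (fun b => ENNReal.ofReal (Real.exp E) * ∫⁻ c, h c ∂(η b)) hf.lintegral_kernel
    (hh.lintegral_kernel.const_mul _) (hη f h hf hh hR) x y hxy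
  rwa [lintegral_const_mul _ hh.lintegral_kernel, ← mul_assoc,
    ← ENNReal.ofReal_mul (Real.exp_pos _).le, ← Real.exp_add] at this

lemma mono (hq : 1 < q) {κ : Kernel X Y} {S : X → X → Prop} {S' : Y → Y → Prop}
    (hκ : RenyiDominated q D R R' κ) (hDE : D ≤ E) (hS : ∀ x y, S x y → R x y)
    (hS' : ∀ x y, R' x y → S' x y) : RenyiDominated q E S S' κ := by
  intro f h hf hh hR x y hxy
  refine (hκ f h hf hh (fun x y hxy => hR x y (hS' x y hxy)) x y (hS x y hxy)).trans ?_
  have : 0 ≤ (q - 1) / q := div_nonneg (by linarith) (by linarith)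
  gcongr

lemma foldl {n : ℕ} {R : Fin (n + 1) → X → X → Prop} {D : Fin n → ℝ}
    {κ : Fin n → Kernel X X}
    (hκ : ∀ i, RenyiDominated q (D i) (R i.castSucc) (R i.succ) (κ i)) :
    RenyiDominated q (∑ i, D i) (R 0) (R (Fin.last n))
      (Fin.foldl n (fun η i => κ i ∘ₖ η) Kernel.id) := by
  induction n with
  | zero => simpa using RenyiDominated.id
  | succ n ih =>
    rw [Fin.foldl_succ_last, Fin.sum_univ_castSucc]
    exact comp (ih (R := fun i => R i.castSucc) fun i => hκ i.castSucc) (hκ (Fin.last n))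

end RenyiDominated

/-! ### Clipping -/

lemma norm_clip_le {n : ℕ} {C : ℝ} (hC : 0 ≤ C) (v : Vec n) : ‖clip C v‖ ≤ C := by
  rw [clip, norm_smul, Real.norm_eq_abs, abs_of_nonneg (by positivity)]
  rcases eq_or_ne v 0 with rfl | hv
  · simpa using hC
  · calc min (C / ‖v‖) 1 * ‖v‖ ≤ C / ‖v‖ * ‖v‖ := by gcongr; exact min_le_left _ _
      _ = C := div_mul_cancel₀ _ (norm_ne_zero_iff.mpr hv)

/-- Splits a gap of size `z + C` into a shift of norm at most `C` and a radial remainder of norm at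
most `z`. -/
lemma norm_sub_clip_le {n : ℕ} {C z : ℝ} (hz : 0 ≤ z) {v : Vec n}
    (hv : ‖v‖ ≤ z + C) : ‖v - clip C v‖ ≤ z := by
  have h : v - clip C v = (1 - min (C / ‖v‖) 1) • v := by rw [clip, sub_smul, one_smul]
  rw [h, norm_smul, Real.norm_eq_abs, abs_of_nonneg (by simp)]
  rcases eq_or_ne v 0 with rfl | hv0
  · simpa using hz
  · have hpos : 0 < ‖v‖ := norm_pos_iff.mpr hv0
    rcases le_total (C / ‖v‖) 1 with h1 | h1
    · rw [min_eq_left h1, sub_mul, div_mul_cancel₀ _ hpos.ne']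
      linarith
    · simpa [min_eq_right h1] using hz

lemma measurable_clip {n : ℕ} (C : ℝ) : Measurable (clip C : Vec n → Vec n) := by
  unfold clip
  fun_prop

/-! ### Coordinates in an orthogonal block decomposition -/

/-- The coordinates `Bᵢ = Aᵢᵀ x` of `x` in the `i`-th block. -/
noncomputable abbrev blockCoord {d n : ℕ} (A : Matrix (Fin d) (Fin n) ℝ) : Vec d →ₗ[ℝ] Vec n :=
  A.transpose.toEuclideanLin

namespace IsBlockDecomposition

variable {d k : ℕ} {r : Fin k → ℕ} {A : ∀ i, Matrix (Fin d) (Fin (r i)) ℝ}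

lemma transpose_mul_self (hA : IsBlockDecomposition A) (i : Fin k) :
    (A i).transpose * A i = 1 := by
  ext a b
  have := congrFun (congrFun hA.2 ⟨i, a⟩) ⟨i, b⟩
  simpa [Matrix.mul_apply, blockConcat, Matrix.one_apply] using this

lemma transpose_mul_of_ne (hA : IsBlockDecomposition A) {i j : Fin k} (hij : i ≠ j) :
    (A i).transpose * A j = 0 := by
  ext a b
  have := congrFun (congrFun hA.2 ⟨i, a⟩) ⟨j, b⟩
  simpa [Matrix.mul_apply, blockConcat, Matrix.one_apply, hij] using this

lemma blockCoord_toEuclideanLin_self (hA : IsBlockDecomposition A) (i : Fin k)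
    (b : Vec (r i)) : blockCoord (A i) ((A i).toEuclideanLin b) = b := by
  ext a
  simp [Matrix.toLpLin_apply, Matrix.mulVec_mulVec, hA.transpose_mul_self]

lemma blockCoord_toEuclideanLin_of_ne (hA : IsBlockDecomposition A) {i j : Fin k} (hij : i ≠ j)
    (b : Vec (r j)) : blockCoord (A i) ((A j).toEuclideanLin b) = 0 := by
  ext a
  simp [Matrix.toLpLin_apply, Matrix.mulVec_mulVec, hA.transpose_mul_of_ne hij]

lemma norm_blockCoord_le (hA : IsBlockDecomposition A) (i : Fin k) (x : Vec d) :
    ‖blockCoord (A i) x‖ ≤ ‖x‖ := by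
  have hinner : ∀ (b : Vec (r i)) (y : Vec d),
      inner ℝ b (blockCoord (A i) y) = inner ℝ ((A i).toEuclideanLin b) y := by
    intro b y
    rw [← LinearMap.adjoint_inner_right, ← Matrix.toEuclideanLin_conjTranspose_eq_adjoint,
      Matrix.conjTranspose_eq_transpose_of_trivial]
  set b := blockCoord (A i) x with hb
  have h1 : ‖b‖ ^ 2 = inner ℝ ((A i).toEuclideanLin b) x := by
    rw [← hinner, ← hb, real_inner_self_eq_norm_sq]
  have h2 : ‖(A i).toEuclideanLin b‖ ^ 2 = ‖b‖ ^ 2 := by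
    rw [← real_inner_self_eq_norm_sq, ← hinner, hA.blockCoord_toEuclideanLin_self,
      real_inner_self_eq_norm_sq]
  have h3 : ‖(A i).toEuclideanLin b‖ = ‖b‖ := by
    simpa using (sq_eq_sq₀ (norm_nonneg _) (norm_nonneg _)).mp h2
  have h4 := real_inner_le_norm ((A i).toEuclideanLin b) x
  rw [← h1, h3] at h4
  nlinarith [norm_nonneg b, norm_nonneg x]

lemma eq_zero_of_blockCoord_eq_zero (hA : IsBlockDecomposition A) {x : Vec d}
    (hx : ∀ i, blockCoord (A i) x = 0) : x = 0 := by
  -- Since the block sizes sum to `d`, the concatenation is square and its left inverse is also a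
  -- right inverse.
  have hcard : Fintype.card (Σ i, Fin (r i)) = Fintype.card (Fin d) := by simp [hA.1]
  have hAA := (Matrix.mul_eq_one_comm_of_equiv (Fintype.equivOfCardEq hcard)).mp hA.2
  have h0 : (blockConcat A).transpose.mulVec x.ofLp = 0 := by
    ext ⟨i, a⟩
    have := congrArg (fun v : Vec (r i) => v a) (hx i)
    simpa [Matrix.toLpLin_apply, Matrix.mulVec, dotProduct, blockConcat] using this
  have h1 : x.ofLp = 0 := by
    rw [← Matrix.one_mulVec x.ofLp, ← hAA, ← Matrix.mulVec_mulVec, h0, Matrix.mulVec_zero]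
  ext a
  simp [h1]

end IsBlockDecomposition

/-! ### One block -/

/-- Two states share the seed, and their models differ by at most `c i` in block `i`. -/
def BlockClose {S : Type*} {d k : ℕ} {r : Fin k → ℕ} (A : ∀ i, Matrix (Fin d) (Fin (r i)) ℝ)
    (c : Fin k → ℝ) (s s' : S × Vec d) : Prop :=
  s.1 = s'.1 ∧ ∀ j, ‖blockCoord (A j) (s.2 - s'.2)‖ ≤ c j

lemma measurable_blockUpdate {S : Type*} [MeasurableSpace S] {d n : ℕ}
    (A : Matrix (Fin d) (Fin n) ℝ) (p : NFTParams) {g : S → Vec d → Vec d}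
    (hg : Measurable (fun s : S × Vec d => g s.1 s.2)) :
    Measurable (fun s : (S × Vec d) × Vec n =>
      (s.1.1, blockUpdate A p (g s.1.1 s.1.2) s.1.2 s.2)) := by
  have h1 : Measurable (A.toEuclideanLin : Vec n → Vec d) :=
    (LinearMap.continuous_of_finiteDimensional _).measurable
  have h2 : Measurable (A.transpose.toEuclideanLin : Vec d → Vec n) :=
    (LinearMap.continuous_of_finiteDimensional _).measurable
  have h3 := measurable_clip (n := n) p.C₁
  have h4 : Measurable (fun s : (S × Vec d) × Vec n => g s.1.1 s.1.2) := hg.comp measurable_fst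
  unfold blockUpdate
  fun_prop

section
variable {S : Type*} [MeasurableSpace S] {d k : ℕ} {r : Fin k → ℕ}
  {A : ∀ i, Matrix (Fin d) (Fin (r i)) ℝ}

lemma lintegral_blockStep {n : ℕ} (A : Matrix (Fin d) (Fin n) ℝ) (p : NFTParams)
    {g : S → Vec d → Vec d} (hg : Measurable (fun s : S × Vec d => g s.1 s.2))
    {f : S × Vec d → ℝ≥0∞} (hf : Measurable f) (s : S × Vec d) :
    ∫⁻ a, f a ∂(blockStep A p g s) =
      ∫⁻ ξ, f (s.1, blockUpdate A p (g s.1 s.2) s.2 ξ) ∂(gaussianNoise n p.σ) := by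
  have hm := measurable_blockUpdate A p hg
  have hfm : Measurable (fun s : (S × Vec d) × Vec n =>
      f (s.1.1, blockUpdate A p (g s.1.1 s.1.2) s.1.2 s.2)) := hf.comp hm
  rw [blockStep, Kernel.lintegral_map _ hm _ hf, Kernel.prod_apply, Kernel.id_apply,
    Kernel.const_apply, lintegral_prod _ hfm.aemeasurable,
    lintegral_dirac' _ hfm.lintegral_prod_right']

lemma isMarkovKernel_blockSteps {n : ℕ} (A : Matrix (Fin d) (Fin n) ℝ) (p : NFTParams)
    {g : ℕ → S → Vec d → Vec d} (hg : ∀ t, Measurable (fun s : S × Vec d => g t s.1 s.2)) (T : ℕ) :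
    IsMarkovKernel (blockSteps A p g T) := by
  induction T with
  | zero => unfold blockSteps; infer_instance
  | succ T ih =>
    have : IsMarkovKernel (blockStep A p (g T)) :=
      Kernel.IsMarkovKernel.map _ (measurable_blockUpdate A p (hg T))
    unfold blockSteps
    infer_instance

/-- One step with shift `a` of the noise: the distance in block `i` goes from `c i` to
`ρ * c i + 2 * γ * C₁ - a`. -/
lemma renyiDominated_blockStep (hA : IsBlockDecomposition A) {q : ℝ} (hq : 1 < q) (i : Fin k)
    {p : NFTParams} (hp : p.Admissible) {g : S → Vec d → Vec d}
    (hg : Measurable (fun s : S × Vec d => g s.1 s.2)) {c : Fin k → ℝ} {a z : ℝ} (ha : 0 ≤ a)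
    (hz : 0 ≤ z) (hza : (1 - p.γ * p.lam) * c i + 2 * p.γ * p.C₁ = z + a) :
    RenyiDominated q (q * a ^ 2 / (2 * p.σ ^ 2)) (BlockClose A c)
      (BlockClose A (Function.update c i z)) (blockStep (A i) p g) := by
  obtain ⟨hγ, -, hγlam, hC, hσ⟩ := hp
  rintro f h hf hh hR ⟨ω, x⟩ ⟨ω', y⟩ ⟨rfl, hxy⟩
  dsimp only at hxy
  rw [lintegral_blockStep _ _ hg hf, lintegral_blockStep _ _ hg hh]
  dsimp only
  let u : Vec d → Vec (r i) := fun w => blockCoord (A i) w -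
    p.γ • (clip p.C₁ (blockCoord (A i) (g ω w)) + p.lam • blockCoord (A i) w)
  set v := u x - u y with hv
  -- The noise of the second run is shifted by `s`, which absorbs up to `a` of the gap `v`; what is
  -- left has norm at most `z`.
  set s := clip a v with hs
  have hupd : ∀ (w : Vec d) (ξ : Vec (r i)), blockCoord (A i)
      (blockUpdate (A i) p (g ω w) w ξ) = u w + ξ := by
    intro w ξ
    rw [blockUpdate, map_add, hA.blockCoord_toEuclideanLin_self]
    simp only [u, blockCoord]
    abel
  have hupd' : ∀ (j : Fin k) (w : Vec d) (ξ : Vec (r i)), j ≠ i → blockCoord (A j)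
      (blockUpdate (A i) p (g ω w) w ξ) = blockCoord (A j) w := by
    intro j w ξ hj
    rw [blockUpdate, map_add, hA.blockCoord_toEuclideanLin_of_ne hj, add_zero]
  -- The gradients may depend on all blocks in any way: each clipped one has norm at most `C₁`.
  have hvnorm : ‖v‖ ≤ z + a := by
    have hveq : v = (1 - p.γ * p.lam) • blockCoord (A i) (x - y) +
        p.γ • (clip p.C₁ (blockCoord (A i) (g ω y)) - clip p.C₁ (blockCoord (A i) (g ω x))) := by
      simp only [hv, u, map_sub]
      module
    have h1 := norm_clip_le hC.le (blockCoord (A i) (g ω x))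
    have h2 := norm_clip_le hC.le (blockCoord (A i) (g ω y))
    have hρ : 0 ≤ 1 - p.γ * p.lam := by linarith
    rw [← hza, hveq]
    refine (norm_add_le _ _).trans (add_le_add ?_ ?_)
    · rw [norm_smul, Real.norm_eq_abs, abs_of_nonneg hρ]
      exact mul_le_mul_of_nonneg_left (hxy i) hρ
    · rw [norm_smul, Real.norm_eq_abs, abs_of_pos hγ]
      nlinarith [norm_sub_le (clip p.C₁ (blockCoord (A i) (g ω y)))
        (clip p.C₁ (blockCoord (A i) (g ω x)))]
  have hclose : ∀ ξ, BlockClose A (Function.update c i z)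
      (ω, blockUpdate (A i) p (g ω x) x ξ) (ω, blockUpdate (A i) p (g ω y) y (s + ξ)) := by
    refine fun ξ => ⟨rfl, fun j => ?_⟩
    rcases eq_or_ne j i with rfl | hj
    · rw [Function.update_self, map_sub, hupd, hupd,
        show u x + ξ - (u y + (s + ξ)) = v - clip a v by rw [hv, hs]; abel]
      exact norm_sub_clip_le hz hvnorm
    · rw [Function.update_of_ne hj, map_sub, hupd' j _ _ hj, hupd' j _ _ hj, ← map_sub]
      exact hxy j
  have hm : Measurable fun ξ => h (ω, blockUpdate (A i) p (g ω y) y ξ) :=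
    hh.comp ((measurable_blockUpdate (A i) p hg).comp (measurable_prodMk_left (x := (ω, y))))
  have hexp : 0 ≤ (q - 1) / q := div_nonneg (by linarith) (by linarith)
  have hsn : ‖s‖ ≤ a := norm_clip_le ha v
  calc ∫⁻ ξ, f (ω, blockUpdate (A i) p (g ω x) x ξ) ∂(gaussianNoise (r i) p.σ)
      ≤ ∫⁻ ξ, h (ω, blockUpdate (A i) p (g ω y) y (s + ξ)) ^ ((q - 1) / q)
          ∂(gaussianNoise (r i) p.σ) := lintegral_mono fun ξ => hR _ _ (hclose ξ)
    _ ≤ _ := lintegral_rpow_add_gaussianNoise_le hq hσ s hm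
    _ ≤ _ := by gcongr

lemma renyiDominated_blockSteps (hA : IsBlockDecomposition A) {q : ℝ} (hq : 1 < q) (i : Fin k)
    {p : NFTParams} (hp : p.Admissible) {g : ℕ → S → Vec d → Vec d}
    (hg : ∀ t, Measurable (fun s : S × Vec d => g t s.1 s.2)) {c : Fin k → ℝ} {a z : ℕ → ℝ}
    (T : ℕ) (h0 : z 0 = c i) (ha : ∀ t < T, 0 ≤ a t) (hz : ∀ t < T, 0 ≤ z (t + 1))
    (hza : ∀ t < T, (1 - p.γ * p.lam) * z t + 2 * p.γ * p.C₁ = z (t + 1) + a t) :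
    RenyiDominated q (∑ t ∈ Finset.range T, q * a t ^ 2 / (2 * p.σ ^ 2)) (BlockClose A c)
      (BlockClose A (Function.update c i (z T))) (blockSteps (A i) p g T) := by
  induction T with
  | zero => simpa [blockSteps, h0] using RenyiDominated.id
  | succ T ih =>
    rw [Finset.sum_range_succ]
    have hstep := renyiDominated_blockStep hA hq i hp (hg T)
      (c := Function.update c i (z T)) (ha T T.lt_succ_self) (hz T T.lt_succ_self)
      (by simpa using hza T T.lt_succ_self)
    rw [Function.update_idem] at hstep
    exact (ih (fun t ht => ha t (by omega)) (fun t ht => hz t (by omega))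
      (fun t ht => hza t (by omega))).comp hstep

end

/-! ### Optimal shifts -/

lemma linearRecursion_eq {ρ b : ℝ} {a z : ℕ → ℝ} (hz : ∀ t, z (t + 1) = ρ * z t + b - a t) (T : ℕ) :
    z T = ρ ^ T * z 0 + ∑ t ∈ Finset.range T, ρ ^ (T - 1 - t) * (b - a t) := by
  induction T with
  | zero => simp
  | succ T ih =>
    rw [hz, ih, Finset.sum_range_succ, mul_add, Finset.mul_sum]
    have : ∀ t ∈ Finset.range T, ρ * (ρ ^ (T - 1 - t) * (b - a t)) =
        ρ ^ (T + 1 - 1 - t) * (b - a t) := by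
      intro t ht
      rw [Finset.mem_range] at ht
      rw [show T + 1 - 1 - t = T - 1 - t + 1 by omega, pow_succ]
      ring
    rw [Finset.sum_congr rfl this]
    simp
    ring

/-- A calibrated block admits shifts `a t` which bring the distance of two runs from `2 * C₀` to
`0`, with total Rényi cost at most `e`. -/
lemma NFTParams.Calibrated.exists_shifts {p : NFTParams} (hp : p.Admissible) {q C₀ e : ℝ}
    (hq : 1 < q) (hC₀ : 0 ≤ C₀) (he : 0 ≤ e) (h : p.Calibrated q C₀ e) :
    ∃ a z : ℕ → ℝ, z 0 = 2 * C₀ ∧ z p.T = 0 ∧ (∀ t < p.T, 0 ≤ a t) ∧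
      (∀ t < p.T, 0 ≤ z (t + 1)) ∧
      (∀ t < p.T, (1 - p.γ * p.lam) * z t + 2 * p.γ * p.C₁ = z (t + 1) + a t) ∧
      ∑ t ∈ Finset.range p.T, q * a t ^ 2 / (2 * p.σ ^ 2) ≤ e := by
  obtain ⟨hγ, hlam, hγlam, hC, hσ⟩ := hp
  unfold NFTParams.Calibrated at h
  set ρ := 1 - p.γ * p.lam with hρ
  set b := 2 * p.γ * p.C₁ with hb
  have hρ0 : 0 < ρ := by linarith
  have hρ1 : ρ ≤ 1 := by have := mul_nonneg hγ.le hlam; linarith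
  have hb0 : 0 < b := by positivity
  set w : ℕ → ℝ := fun t => ρ ^ (p.T - 1 - t) with hw
  set W := ∑ t ∈ Finset.range p.T, w t ^ 2 with hW
  set G := ρ ^ p.T * (2 * C₀) + ∑ t ∈ Finset.range p.T, w t * b with hG
  have hw0 : ∀ t, 0 < w t := fun t => by positivity
  -- Truncated subtraction makes `w` constantly `1` from `p.T - 1` on, so monotonicity holds for
  -- every `t`.
  have hwmono : ∀ t, w t ≤ w (t + 1) := fun t =>
    pow_le_pow_of_le_one hρ0.le hρ1 (by omega)
  have hG0 : 0 ≤ G := add_nonneg (by positivity)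
    (Finset.sum_nonneg fun t _ => mul_nonneg (hw0 t).le hb0.le)
  have hW0 : 0 ≤ W := Finset.sum_nonneg fun t _ => by positivity
  have hGsq : G ^ 2 ≤ 2 * e * p.σ ^ 2 / q * W := by
    calc G ^ 2 ≤ (Real.sqrt (2 * e * p.σ ^ 2 / q) * Real.sqrt W) ^ 2 := by gcongr
      _ = _ := by rw [mul_pow, Real.sq_sqrt (by positivity), Real.sq_sqrt hW0]
  have hWT : p.T = 0 ∨ 0 < W := by
    rcases Nat.eq_zero_or_pos p.T with hT | hT
    · exact Or.inl hT
    · exact Or.inr (Finset.sum_pos (fun t _ => by have := hw0 t; positivity)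
        ⟨0, Finset.mem_range.mpr hT⟩)
  -- Shifts proportional to the weights are the equality case of Cauchy–Schwarz: they minimize `∑ a
  -- t ^ 2` subject to `∑ w t * a t = G`, the condition for the final gap to vanish.
  let a : ℕ → ℝ := fun t => G / W * w t
  let z : ℕ → ℝ := fun t => Nat.rec (2 * C₀) (fun t y => ρ * y + b - a t) t
  have hz : ∀ t, z (t + 1) = ρ * z t + b - a t := fun t => rfl
  have ha0 : ∀ t, 0 ≤ a t := fun t => mul_nonneg (div_nonneg hG0 hW0) (hw0 t).le
  have hamono : ∀ t, a t ≤ a (t + 1) := fun t =>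
    mul_le_mul_of_nonneg_left (hwmono t) (div_nonneg hG0 hW0)
  have hzT : z p.T = 0 := by
    rcases hWT with hT | hWpos
    -- With no steps, the right side of the calibration is `0` and forces `C₀ = 0`.
    · have h0 : z p.T = 2 * C₀ := by rw [hT]; rfl
      simp only [hG, hW, hT] at h
      simp at h
      rw [h0]
      linarith
    · have h1 := linearRecursion_eq hz p.T
      have h2 : ∑ t ∈ Finset.range p.T, w t * (b - a t) =
          ∑ t ∈ Finset.range p.T, w t * b - G / W * W := by
        rw [hW, Finset.mul_sum, ← Finset.sum_sub_distrib]
        exact Finset.sum_congr rfl fun t _ => by simp only [a]; ring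
      rw [h1, h2, div_mul_cancel₀ _ hWpos.ne']
      change ρ ^ p.T * (2 * C₀) + _ = 0
      rw [hG]
      ring
  -- The gap can first turn negative only if `a t` exceeds `b`, and this persists because `a` is
  -- nondecreasing. It then stays negative forever, contradicting `z p.T = 0`.
  have hdich : ∀ t, 0 ≤ z t ∨ z t < 0 ∧ b < a t := by
    intro t
    induction t with
    | zero => exact Or.inl (by change 0 ≤ 2 * C₀; linarith)
    | succ t ih =>
      by_contra! hcon
      obtain ⟨hneg, hle⟩ := hcon
      have hle := hle hneg
      rw [hz] at hneg
      have := hamono t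
      rcases ih with h0 | ⟨_, h1⟩
      · have := mul_nonneg hρ0.le h0
        linarith
      · linarith
  have hznonneg : ∀ t ≤ p.T, 0 ≤ z t := by
    intro t ht
    by_contra hneg
    rw [not_le] at hneg
    have hall : ∀ u, z (t + u) < 0 := by
      intro u
      induction u with
      | zero => exact hneg
      | succ u ih =>
        rw [← add_assoc, hz]
        have h1 := ((hdich (t + u)).resolve_left (not_le.mpr ih)).2
        have h2 := mul_neg_of_pos_of_neg hρ0 ih
        linarith
    have := hall (p.T - t)
    rw [Nat.add_sub_cancel' ht, hzT] at this
    exact lt_irrefl _ this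
  refine ⟨a, z, rfl, hzT, fun t _ => ha0 t, fun t ht => hznonneg _ ht,
    fun t _ => by rw [hz]; ring, ?_⟩
  rcases hWT with hT | hWpos
  · simpa [hT] using he
  · have hsum : ∑ t ∈ Finset.range p.T, q * a t ^ 2 / (2 * p.σ ^ 2) =
        q / (2 * p.σ ^ 2) * (G ^ 2 / W) := by
      have : q / (2 * p.σ ^ 2) * (G ^ 2 / W) = q / (2 * p.σ ^ 2) * (G / W) ^ 2 * W := by
        field_simp
      rw [this, hW, Finset.mul_sum]
      exact Finset.sum_congr rfl fun t _ => by simp only [a]; ring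
    rw [hsum]
    have hq0 : 0 < q := by linarith
    calc q / (2 * p.σ ^ 2) * (G ^ 2 / W)
        ≤ q / (2 * p.σ ^ 2) * (2 * e * p.σ ^ 2 / q * W / W) := by gcongr
      _ = e := by field_simp

/-! ### All blocks -/

section
variable {S : Type*} [MeasurableSpace S] {d k : ℕ} {r : Fin k → ℕ}
  {A : ∀ i, Matrix (Fin d) (Fin (r i)) ℝ} {p : Fin k → NFTParams}
  {g : Fin k → ℕ → S → Vec d → Vec d}

lemma isMarkovKernel_allBlocks (A : ∀ i, Matrix (Fin d) (Fin (r i)) ℝ) (p : Fin k → NFTParams)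
    (hg : ∀ i t, Measurable (fun s : S × Vec d => g i t s.1 s.2)) :
    IsMarkovKernel (allBlocks A p g) := by
  have key : ∀ (n : ℕ) (κ : Fin n → Kernel (S × Vec d) (S × Vec d)),
      (∀ i, IsMarkovKernel (κ i)) →
      IsMarkovKernel (Fin.foldl n (fun η i => κ i ∘ₖ η) Kernel.id) := by
    intro n
    induction n with
    | zero => intro κ _; rw [Fin.foldl_zero]; infer_instance
    | succ n ih =>
      intro κ hκ
      rw [Fin.foldl_succ_last]
      have := ih (fun i => κ i.castSucc) fun i => hκ _
      have := hκ (Fin.last n)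
      infer_instance
  exact key k _ fun i => isMarkovKernel_blockSteps (A i) (p i) (hg i) _

/-- Processing all blocks brings two states with the same seed, at distance at most `2 * C₀`,
together, with total Rényi cost the sum of the budgets. -/
lemma renyiDominated_allBlocks (hA : IsBlockDecomposition A) (hp : ∀ i, (p i).Admissible)
    (hg : ∀ i t, Measurable (fun s : S × Vec d => g i t s.1 s.2)) {q C₀ : ℝ} (hq : 1 < q)
    (hC₀ : 0 ≤ C₀) {e : Fin k → ℝ} (he : ∀ i, 0 ≤ e i) (hcal : ∀ i, (p i).Calibrated q C₀ (e i)) :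
    RenyiDominated q (∑ i, e i)
      (fun s s' : S × Vec d => s.1 = s'.1 ∧ ‖s.2 - s'.2‖ ≤ 2 * C₀) Eq (allBlocks A p g) := by
  -- Gap bounds after `m` blocks: processed blocks agree, the others keep the initial bound.
  let c : Fin (k + 1) → Fin k → ℝ := fun m j => if j.castSucc < m then 0 else 2 * C₀
  have hstep : ∀ i : Fin k, RenyiDominated q (e i) (BlockClose (S := S) A (c i.castSucc))
      (BlockClose A (c i.succ)) (blockSteps (A i) (p i) (g i) (p i).T) := by
    intro i
    obtain ⟨a, z, hz0, hzT, ha, hz, hza, hcost⟩ := (hcal i).exists_shifts (hp i) hq hC₀ (he i)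
    have h := renyiDominated_blockSteps hA hq i (hp i) (hg i) (c := c i.castSucc) (p i).T
      (by simpa [c] using hz0) ha hz hza
    have hc : Function.update (c i.castSucc) i (z (p i).T) = c i.succ := by
      ext j
      rcases eq_or_ne j i with rfl | hj
      · simp [c, hzT]
      · rw [Function.update_of_ne hj]
        have : j.castSucc < i.succ ↔ j.castSucc < i.castSucc := by
          simp only [Fin.lt_def, Fin.val_castSucc, Fin.val_succ]
          have := Fin.val_ne_of_ne hj
          omega
        simp only [c, this]
    rw [hc] at h
    exact h.mono hq hcost (fun _ _ h => h) (fun _ _ h => h)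
  refine (RenyiDominated.foldl (R := fun m => BlockClose (S := S) A (c m)) hstep).mono hq le_rfl
    ?_ ?_
  · rintro s s' ⟨hs, hd⟩
    exact ⟨hs, fun j => by simpa [c] using (hA.norm_blockCoord_le j _).trans hd⟩
  · rintro ⟨ω, x⟩ ⟨ω', y⟩ ⟨hω, hc⟩
    have : x - y = 0 := hA.eq_zero_of_blockCoord_eq_zero fun i =>
      norm_le_zero_iff.mp (by simpa [c, Fin.castSucc_lt_last] using hc i)
    exact Prod.ext hω (sub_eq_zero.mp this)

end

/-! ### From Rényi domination to indistinguishability -/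

/-- Put `y = exp D * x` and split at `y = δ ^ (q / (q - 1))`. Below, the left side is at most `δ`.
Above, it is `y * y ^ (-1 / q)`, and the second factor is at most `δ ^ (-1 / (q - 1))`. -/
lemma rpow_le_exp_mul_add {q D δ : ℝ} (hq : 1 < q) (hδ : 0 < δ) (x : ℝ≥0∞) :
    (ENNReal.ofReal (Real.exp D) * x) ^ ((q - 1) / q) ≤
      ENNReal.ofReal (Real.exp (D + Real.log (1 / δ) / (q - 1))) * x + ENNReal.ofReal δ := by
  have hq0 : 0 < q := by linarith
  have hq1 : 0 < q - 1 := by linarith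
  rcases eq_or_ne x ⊤ with rfl | hx
  · rw [ENNReal.mul_top (a := ENNReal.ofReal (Real.exp (D + Real.log (1 / δ) / (q - 1))))
      (by simp [Real.exp_pos]), top_add]
    exact le_top
  lift x to NNReal using hx
  rw [← ENNReal.ofReal_coe_nnreal, ← ENNReal.ofReal_mul (Real.exp_pos _).le,
    ← ENNReal.ofReal_mul (Real.exp_pos _).le,
    ENNReal.ofReal_rpow_of_nonneg (by positivity) (by positivity),
    ← ENNReal.ofReal_add (by positivity) hδ.le]
  apply ENNReal.ofReal_le_ofReal
  have hx0 : (0 : ℝ) ≤ x := x.2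
  rw [Real.exp_add, mul_right_comm]
  set y := Real.exp D * (x : ℝ) with hy
  have hy0 : 0 ≤ y := by positivity
  rw [show Real.log (1 / δ) / (q - 1) = Real.log δ * (-1 / (q - 1)) by
      rw [one_div, Real.log_inv]; ring, ← Real.rpow_def_of_pos hδ]
  rcases le_or_gt y (δ ^ (q / (q - 1))) with h | h
  · calc y ^ ((q - 1) / q) ≤ (δ ^ (q / (q - 1))) ^ ((q - 1) / q) :=
          Real.rpow_le_rpow hy0 h (by positivity)
      _ = δ := by
          rw [← Real.rpow_mul hδ.le, show q / (q - 1) * ((q - 1) / q) = 1 by field_simp,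
            Real.rpow_one]
      _ ≤ _ := le_add_of_nonneg_left (by positivity)
  · have hypos : 0 < y := lt_of_le_of_lt (by positivity) h
    calc y ^ ((q - 1) / q) = y * y ^ (-1 / q) := by
          rw [show (q - 1) / q = 1 + -1 / q by field_simp; ring, Real.rpow_add hypos, Real.rpow_one]
      _ ≤ y * (δ ^ (q / (q - 1))) ^ (-1 / q) := by
          gcongr y * ?_
          exact Real.rpow_le_rpow_of_nonpos (by positivity) h.le
            (div_nonpos_of_nonpos_of_nonneg (by norm_num) hq0.le)
      _ = y * δ ^ (-1 / (q - 1)) := by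
          rw [← Real.rpow_mul hδ.le, show q / (q - 1) * (-1 / q) = -1 / (q - 1) by field_simp]
      _ ≤ _ := le_add_of_nonneg_right hδ.le

/-- If the laws `κ x` and `κ y` are indistinguishable for almost all pairs `(x, y)` under `π`, then
so are the outputs of `κ` on the two marginals of `π`. -/
lemma indistinguishable_comp_of_ae {X Y : Type*} [MeasurableSpace X] [MeasurableSpace Y] {ε δ : ℝ}
    (κ : Kernel X Y) (π : Measure (X × X)) (hπ : π Set.univ ≤ 1)
    (h : ∀ᵐ z ∂π, Indistinguishable ε δ (κ z.1) (κ z.2)) :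
    Indistinguishable ε δ (κ ∘ₘ π.map Prod.fst) (κ ∘ₘ π.map Prod.snd) := by
  intro O hO
  have hκ := κ.measurable_coe hO
  have hbound : ∀ {f f' : X × X → X}, Measurable f → Measurable f' →
      (∀ᵐ z ∂π, κ (f z) O ≤ ENNReal.ofReal (Real.exp ε) * κ (f' z) O + ENNReal.ofReal δ) →
      (κ ∘ₘ π.map f) O ≤ ENNReal.ofReal (Real.exp ε) * (κ ∘ₘ π.map f') O + ENNReal.ofReal δ := by
    intro f f' hf hf' hle
    rw [Measure.bind_apply hO κ.aemeasurable, Measure.bind_apply hO κ.aemeasurable,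
      lintegral_map hκ hf, lintegral_map hκ hf']
    calc ∫⁻ z, κ (f z) O ∂π
        ≤ ∫⁻ z, (ENNReal.ofReal (Real.exp ε) * κ (f' z) O + ENNReal.ofReal δ) ∂π :=
          lintegral_mono_ae hle
      _ = ENNReal.ofReal (Real.exp ε) * ∫⁻ z, κ (f' z) O ∂π
            + ENNReal.ofReal δ * π Set.univ := by
          rw [lintegral_add_right _ measurable_const,
            lintegral_const_mul _ (f := fun z => κ (f' z) O) (hκ.comp hf'), lintegral_const]
      _ ≤ _ := by gcongr; exact mul_le_of_le_one_right' hπ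
  exact ⟨hbound measurable_fst measurable_snd (h.mono fun z hz => (hz O hO).1),
    hbound measurable_snd measurable_fst (h.mono fun z hz => (hz O hO).2)⟩

/-! ### Block-wise noisy fine-tuning -/

section
variable {Z S : Type*} [DecidableEq Z] [MeasurableSpace S] {d k : ℕ} {r : Fin k → ℕ}
  {A : ∀ i, Matrix (Fin d) (Fin (r i)) ℝ} {p : Fin k → NFTParams}
  {g : Finset Z → Fin k → ℕ → S → Vec d → Vec d}
  {ν : Finset Z → Measure S} [∀ D, IsProbabilityMeasure (ν D)]
  {F : Finset Z → Kernel (Vec d) (Vec d)}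

lemma isMarkovKernel_blockwiseNFT [∀ D, IsMarkovKernel (F D)]
    (hg : ∀ D i t, Measurable (fun s : S × Vec d => g D i t s.1 s.2))
    (D Df : Finset Z) : IsMarkovKernel (blockwiseNFT A p g ν F D Df) := by
  have := isMarkovKernel_allBlocks A p (hg (D \ Df))
  have := Kernel.IsMarkovKernel.map (allBlocks A p (g (D \ Df)) ∘ₖ
    (Kernel.const (Vec d) (ν (D \ Df)) ×ₖ Kernel.id)) measurable_snd
  unfold blockwiseNFT
  infer_instance

lemma lintegral_blockwiseNFT (D Df : Finset Z) {f : Vec d → ℝ≥0∞} (hf : Measurable f) (x : Vec d) :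
    ∫⁻ w, f w ∂(blockwiseNFT A p g ν F D Df x) =
      ∫⁻ ω, ∫⁻ s, ∫⁻ w, f w ∂(F (D \ Df) s.2) ∂(allBlocks A p (g (D \ Df)) (ω, x))
        ∂(ν (D \ Df)) := by
  have h1 : Measurable fun s : S × Vec d => ∫⁻ w, f w ∂(F (D \ Df) s.2) :=
    hf.lintegral_kernel.comp measurable_snd
  have h2 : Measurable fun s : S × Vec d => ∫⁻ s', ∫⁻ w, f w ∂(F (D \ Df) s'.2)
      ∂(allBlocks A p (g (D \ Df)) s) := h1.lintegral_kernel
  rw [blockwiseNFT, Kernel.lintegral_comp _ _ _ hf,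
    Kernel.lintegral_map _ measurable_snd _ hf.lintegral_kernel, Kernel.lintegral_comp _ _ _ h1,
    Kernel.prod_apply, Kernel.const_apply, Kernel.id_apply, lintegral_prod _ h2.aemeasurable]
  refine lintegral_congr fun ω => ?_
  exact lintegral_dirac' _ (h2.comp measurable_prodMk_left)

lemma indistinguishable_blockwiseNFT_apply [∀ D, IsMarkovKernel (F D)]
    (hA : IsBlockDecomposition A)
    (hp : ∀ i, (p i).Admissible)
    (hg : ∀ D i t, Measurable (fun s : S × Vec d => g D i t s.1 s.2)) {q δ C₀ : ℝ} (hq : 1 < q)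
    (hδ : 0 < δ) {e : Fin k → ℝ} (he : ∀ i, 0 ≤ e i) (hcal : ∀ i, (p i).Calibrated q C₀ (e i))
    (D Df : Finset Z) {x y : Vec d} (hxy : ‖x - y‖ ≤ 2 * C₀) :
    Indistinguishable (∑ i, e i + Real.log (1 / δ) / (q - 1)) δ
      (blockwiseNFT A p g ν F D Df x) (blockwiseNFT A p g ν F D Df y) := by
  have hC₀ : 0 ≤ C₀ := by linarith [norm_nonneg (x - y)]
  have key : ∀ {x y : Vec d}, ‖x - y‖ ≤ 2 * C₀ → ∀ O, MeasurableSet O →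
      blockwiseNFT A p g ν F D Df x O ≤
        ENNReal.ofReal (Real.exp (∑ i, e i + Real.log (1 / δ) / (q - 1))) *
          blockwiseNFT A p g ν F D Df y O + ENNReal.ofReal δ := by
    intro x y hxy O hO
    have hind : Measurable (O.indicator (1 : Vec d → ℝ≥0∞)) := measurable_one.indicator hO
    have hFO : Measurable fun s : S × Vec d => F (D \ Df) s.2 O :=
      ((F (D \ Df)).measurable_coe hO).comp measurable_snd
    simp only [← lintegral_indicator_one hO]
    rw [lintegral_blockwiseNFT D Df hind, lintegral_blockwiseNFT D Df hind]
    simp only [lintegral_indicator_one hO]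
    have hint : Measurable fun ω => ∫⁻ s, F (D \ Df) s.2 O
        ∂(allBlocks A p (g (D \ Df)) (ω, y)) :=
      hFO.lintegral_kernel.comp measurable_prodMk_right
    calc _ ≤ ∫⁻ ω, (ENNReal.ofReal (Real.exp (∑ i, e i + Real.log (1 / δ) / (q - 1))) *
            ∫⁻ s, F (D \ Df) s.2 O ∂(allBlocks A p (g (D \ Df)) (ω, y)) + ENNReal.ofReal δ)
            ∂(ν (D \ Df)) := by
          -- The conversion is made for each fixed seed; its affine bound can then be integrated
          -- over the common seed law.
          refine lintegral_mono fun ω => ?_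
          refine le_trans ?_ (rpow_le_exp_mul_add hq hδ _)
          refine renyiDominated_allBlocks hA hp (hg (D \ Df)) hq hC₀ he hcal _ _ hFO hFO ?_
            (ω, x) (ω, y) ⟨rfl, hxy⟩
          rintro s _ rfl
          -- Final fine-tuning is post-processing: its event probability is at most `1`, so it can
          -- serve as both test functions.
          calc F (D \ Df) s.2 O = F (D \ Df) s.2 O ^ (1 : ℝ) := (ENNReal.rpow_one _).symm
            _ ≤ F (D \ Df) s.2 O ^ ((q - 1) / q) :=
              ENNReal.rpow_le_rpow_of_exponent_ge prob_le_one
                ((div_le_one (by linarith)).mpr (by linarith))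
      _ = _ := by
          rw [lintegral_add_right _ measurable_const, lintegral_const_mul _ hint, lintegral_const,
            measure_univ, mul_one]
  exact fun O hO => ⟨key hxy O hO, key (by rwa [norm_sub_rev]) O hO⟩

end

theorem theorem2 {Z S : Type*} [DecidableEq Z] [MeasurableSpace S] {d k : ℕ} {r : Fin k → ℕ}
    (A : ∀ i, Matrix (Fin d) (Fin (r i)) ℝ) (hA : IsBlockDecomposition A)
    (p : Fin k → NFTParams) (hp : ∀ i, (p i).Admissible)
    (g : Finset Z → Fin k → ℕ → S → Vec d → Vec d)
    (hg : ∀ D i t, Measurable (fun s : S × Vec d => g D i t s.1 s.2))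
    (ν : Finset Z → Measure S) [∀ D, IsProbabilityMeasure (ν D)]
    (F : Finset Z → Kernel (Vec d) (Vec d)) [∀ D, IsMarkovKernel (F D)]
    (𝒜 : Finset Z → Measure (Vec d)) [∀ D, IsProbabilityMeasure (𝒜 D)]
    (q δ : ℝ) (hq : 1 < q) (hδ0 : 0 < δ) (hδ1 : δ ≤ 1)
    (εR : Fin k → ℝ) (hεR : ∀ i, 0 ≤ εR i)
    (ε : ℝ) (hε : ε = ∑ i, εR i + Real.log (1 / δ) / (q - 1)) :
    -- the two expressions for the total budget agree
    ε = ∑ i, rdpToDP q δ (εR i) - ((k : ℝ) - 1) * (Real.log (1 / δ) / (q - 1)) ∧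
    -- without model clipping, conditionally on proximity of the two trained models
    (∀ (π : Finset Z → Finset Z → Measure (Vec d × Vec d)) (ρ Δ : ℝ), 0 < ρ → ρ < 1 →
      (∀ i, (p i).Calibrated q (Δ / 2) (εR i)) →
      ∀ D Df : Finset Z, Df ⊆ D → IsCoupling (π D Df) (𝒜 D) (𝒜 (D \ Df)) →
        initialDiscrepancy (π D Df) ρ ≤ Δ →
        Indistinguishable ε δ
          (blockwiseNFT A p g ν F D Df ∘ₘ ((π D Df)[|proximityEvent d Δ]).map Prod.fst)
          (blockwiseNFT A p g ν F (D \ Df) ∅ ∘ₘ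
            ((π D Df)[|proximityEvent d Δ]).map Prod.snd)) ∧
    -- with model clipping to radius `C₀`, unconditionally
    (∀ C₀ : ℝ, 0 < C₀ → (∀ i, (p i).Calibrated q C₀ (εR i)) →
      CertifiesUnlearning ε δ 𝒜 (clippedBlockwiseNFT C₀ A p g ν F)
        (fun Dr => clippedBlockwiseNFT C₀ A p g ν F Dr ∅ ∘ₘ 𝒜 Dr) ∧
      IsUnlearning ε δ 𝒜 (clippedBlockwiseNFT C₀ A p g ν F)) := by 
  have hsdiff : ∀ D Df : Finset Z,
      blockwiseNFT A p g ν F (D \ Df) ∅ = blockwiseNFT A p g ν F D Df := by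
    intro D Df
    simp only [blockwiseNFT, Finset.sdiff_empty]
  refine ⟨?_, ?_, ?_⟩
  · simp only [rdpToDP, Finset.sum_add_distrib, Finset.sum_const, Finset.card_univ,
      Fintype.card_fin, nsmul_eq_mul, hε]
    ring
  · intro π ρ Δ _ _ hcal D Df _ _ _
    have hmeas : MeasurableSet (proximityEvent d Δ) :=
      (isClosed_le (by fun_prop) continuous_const).measurableSet
    rw [hsdiff, hε]
    refine indistinguishable_comp_of_ae _ _ ?_ ?_
    -- Conditioning gives total mass at most `1`, whatever the probability of the event.
    · rw [cond_apply hmeas, Set.inter_univ]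
      exact ENNReal.inv_mul_le_one _
    · filter_upwards [ae_cond_mem hmeas] with z hz
      exact indistinguishable_blockwiseNFT_apply hA hp hg hq hδ0 hεR hcal D Df
        (by rw [mul_div_cancel₀ _ two_ne_zero]; exact hz)
  · intro C₀ hC₀ hcal
    have hclip : Measurable (clip C₀ : Vec d → Vec d) := measurable_clip C₀
    have hcert : CertifiesUnlearning ε δ 𝒜 (clippedBlockwiseNFT C₀ A p g ν F)
        (fun Dr => clippedBlockwiseNFT C₀ A p g ν F Dr ∅ ∘ₘ 𝒜 Dr) := by
      intro D Df _
      have hcsdiff : clippedBlockwiseNFT C₀ A p g ν F (D \ Df) ∅ =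
          clippedBlockwiseNFT C₀ A p g ν F D Df := by
        rw [clippedBlockwiseNFT, clippedBlockwiseNFT, hsdiff]
      have happly : ∀ x, clippedBlockwiseNFT C₀ A p g ν F D Df x =
          blockwiseNFT A p g ν F D Df (clip C₀ x) := by
        intro x
        rw [clippedBlockwiseNFT, Kernel.comp_apply, Kernel.map_apply _ hclip, Kernel.id_apply,
          Measure.map_dirac' hclip, Measure.dirac_bind (Kernel.measurable _)]
      -- Any coupling would do, since clipping puts every pair within `2 * C₀`; the product is used.
      have h := indistinguishable_comp_of_ae (ε := ε) (δ := δ)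
        (clippedBlockwiseNFT C₀ A p g ν F D Df) ((𝒜 D).prod (𝒜 (D \ Df))) prob_le_one
        (Filter.Eventually.of_forall fun z => by
          rw [happly, happly, hε]
          refine indistinguishable_blockwiseNFT_apply hA hp hg hq hδ0 hεR hcal D Df ?_
          have h1 := norm_clip_le hC₀.le z.1
          have h2 := norm_clip_le hC₀.le z.2
          linarith [norm_sub_le (clip C₀ z.1) (clip C₀ z.2)])
      simpa [Measure.map_fst_prod, Measure.map_snd_prod, hcsdiff] using h
    refine ⟨hcert, _, fun D => ?_, hcert⟩
    have := isMarkovKernel_blockwiseNFT (A := A) (p := p) (ν := ν) (F := F) hg D ∅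
    have : IsMarkovKernel (clippedBlockwiseNFT C₀ A p g ν F D ∅) := by
      have := Kernel.IsMarkovKernel.map (Kernel.id (α := Vec d)) hclip
      unfold clippedBlockwiseNFT
      infer_instance
    infer_instance
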